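/- **Model.** Consider a synchronous complete network of $n\ge 2$ nodes in the CONGEST and $KT_0$ model: in each round a node may send, through each of its $n-1$ ports, one message of $O(\operatorname{polylog} n)$ bits, and it does not know which port leads to which node. A public-key infrastructure is given: every node holds a secret key, the list of all $n$ (distinct) public keys is common knowledge, and nodes can sign messages with ideal (unforgeable) digital signatures of $O(\log n)$ bits. A keyed hash function $H$ is common knowledge. The nodes have access to an unbiased global coin (shared random bits) and to private random bits. Each node $u$ has an input value $x_u$ of $O(\log n)$ bits. A static (non-adaptive) adversary fixes the wiring of the ports, the inputs and the set of $f$ Byzantine nodes before any coin is tossed. During the execution it has full information and is rushing: it knows the coin tosses and states of all nodes and sees the messages of the honest nodes in a round before the Byzantine nodes send theirs. The Byzantine nodes share their secret keys and may send arbitrary messages or none, but cannot forge signatures of honest nodes. *Byzantine agreement* is achieved if (i) every honest node decides on a value (termination); (ii) all honest nodes decide on the same value (consistency); (iii) if all honest nodes have the same input value, they decide on that value (validity). **Theorem (Explicit Agreement).** Let $\varepsilon>0$ and $\gamma>0$ be arbitrary constants. There is a randomized algorithm in this model, using the global coin, such that whenever $f\le(1/2-\varepsilon)n$, against every such adversary,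 it achieves Byzantine agreement with probability at least $1-1/n^{\gamma}$, runs for $O(\log^2 n)$ rounds, and the honest nodes send $O(n\log n)$ messages in total. The constants depend only on $\varepsilon$, $\gamma$ and the constants in the $O(\log n)$ bounds on the lengths of inputs and signatures. -/

import Mathlib

namespace AuthBA

/-- What the trusted set-up of an `n`-node network publishes. Node `u` holds the secret key that
belongs to `pk u`, and every node knows which entry of the list `pk` is its own. `H` is the keyed
hash function, computable by everybody; nothing is demanded of it. `sigLen` is the length in bits
of a digital signature (the security parameter). -/
structure PublicSetup (n : ℕ) where
  keyLen : ℕ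
  hashKeyLen : ℕ
  hashLen : ℕ
  sigLen : ℕ
  pk : Fin n ↪ BitVec keyLen
  H : BitVec hashKeyLen → BitVec keyLen → BitVec hashLen

/-- Messages of the network: bit strings, messages signed under the key `pk i`, and
concatenations. Signatures are ideal: `sig i m` is always accepted as a signature of `i` on `m`,
and who is able to produce it is governed by `Derivable`. -/
inductive Msg (n : ℕ) : Type
  | data (l : List Bool)
  | sig (i : Fin n) (m : Msg n)
  | pair (a b : Msg n)

/-- Length of a message in bits, for signatures of `sigLen` bits. A signed message consists of the
message, the name of the signer and the signature; one further bit per constructor pays for the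
structure of the message. -/
def Msg.size {n : ℕ} (sigLen : ℕ) : Msg n → ℕ
  | .data l => l.length + 1
  | .sig _ m => m.size sigLen + Nat.clog 2 n + sigLen + 1
  | .pair a b => a.size sigLen + b.size sigLen + 1

/-- `Derivable keys known m`: a party that holds the secret keys of the nodes in `keys` and has
seen the messages in `known` can produce the message `m`. Every bit string can be produced, but a
signature of a node outside `keys` only by copying it. -/
inductive Derivable {n : ℕ} (keys : Set (Fin n)) (known : Set (Msg n)) : Msg n → Prop
  | seen {m : Msg n} (h : m ∈ known) : Derivable keys known m
  | data (l : List Bool) : Derivable keys known (.data l)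
  | pair {a b : Msg n} (ha : Derivable keys known a) (hb : Derivable keys known b) :
      Derivable keys known (.pair a b)
  | fst {a b : Msg n} (h : Derivable keys known (.pair a b)) : Derivable keys known a
  | snd {a b : Msg n} (h : Derivable keys known (.pair a b)) : Derivable keys known b
  | sign {i : Fin n} {m : Msg n} (hi : i ∈ keys) (h : Derivable keys known m) :
      Derivable keys known (.sig i m)
  | content {i : Fin n} {m : Msg n} (h : Derivable keys known (.sig i m)) :
      Derivable keys known m

/-- A randomized synchronous protocol for `n` nodes with inputs of `ℓ` bits. A node starts from the
position of its own key in the published list, its input, the tosses of the global coin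
(the same for all nodes) and its private coin tosses. In each of the `rounds` rounds it sends at
most one message through each of its `n - 1` ports and then updates its state by what has arrived
at its ports. A node does not know which port leads to which node. At the end it decides on a
value, or is undecided. -/
structure Protocol (n ℓ : ℕ) where
  rounds : ℕ
  coinLen : ℕ
  privLen : ℕ
  State : Type
  init : Fin n → BitVec ℓ → (Fin coinLen → Bool) → (Fin privLen → Bool) → State
  send : State → Fin (n - 1) → Option (Msg n)
  recv : State → (Fin (n - 1) → Option (Msg n)) → State
  decide : State → Option (BitVec ℓ)

/-- The tosses of the global coin and the private coin tosses of all nodes. -/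
abbrev Protocol.Coins {n ℓ : ℕ} (P : Protocol n ℓ) : Type :=
  (Fin P.coinLen → Bool) × (Fin n → Fin P.privLen → Bool)

/-- What is fixed before any coin is tossed: the wiring of the complete graph (`port u p` is the
node at the other end of port `p` of node `u`), the inputs, and the set of Byzantine nodes. -/
structure Environment (n ℓ : ℕ) where
  port : ∀ u : Fin n, Fin (n - 1) ≃ {v : Fin n // v ≠ u}
  input : Fin n → BitVec ℓ
  byz : Finset (Fin n)

/-- All the traffic of an execution: `τ t u p` is what node `u` sends through its port `p` in
round `t` (rounds are numbered from `0`). -/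
abbrev Trace (n : ℕ) : Type := ℕ → Fin n → Fin (n - 1) → Option (Msg n)

/-- What arrives at port `q` of node `v` in round `t`. -/
def Environment.received {n ℓ : ℕ} (E : Environment n ℓ) (τ : Trace n) (t : ℕ) (v : Fin n)
    (q : Fin (n - 1)) : Option (Msg n) :=
  τ t (E.port v q) ((E.port (E.port v q)).symm ⟨v, (E.port v q).2.symm⟩)

/-- The state of the node `u` before round `t` if it follows the protocol. -/
def Protocol.state {n ℓ : ℕ} (P : Protocol n ℓ) (E : Environment n ℓ) (ω : P.Coins) (τ : Trace n)
    (u : Fin n) : ℕ → P.State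
  | 0 => P.init u (E.input u) ω.1 (ω.2 u)
  | t + 1 => P.recv (P.state E ω τ u t) (E.received τ t u)

/-- What the adversary has seen when the Byzantine nodes have to send in round `t`: everything that
the honest nodes have sent up to and including this round. -/
def Environment.adversaryView {n ℓ : ℕ} (E : Environment n ℓ) (τ : Trace n) (t : ℕ) :
    Set (Msg n) :=
  {m | ∃ s ≤ t, ∃ u ∉ E.byz, ∃ p, τ s u p = some m}

/-- What the node `u` has received before round `t`. -/
def Environment.nodeView {n ℓ : ℕ} (E : Environment n ℓ) (τ : Trace n) (t : ℕ) (u : Fin n) :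
    Set (Msg n) :=
  {m | ∃ s < t, ∃ q, E.received τ s u q = some m}

/-- `τ` is a possible traffic of the protocol for the coin tosses `ω`: honest nodes follow the
protocol, and Byzantine nodes, who share their secret keys and see all messages, send whatever they
like (or nothing), except that they cannot forge signatures of honest nodes. -/
structure Protocol.IsExecution {n ℓ : ℕ} (P : Protocol n ℓ) (E : Environment n ℓ) (ω : P.Coins)
    (τ : Trace n) : Prop where
  honest : ∀ t < P.rounds, ∀ u ∉ E.byz, ∀ p, τ t u p = P.send (P.state E ω τ u t) p
  unforgeable : ∀ t < P.rounds, ∀ u ∈ E.byz, ∀ p, ∀ m, τ t u p = some m →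
    Derivable (E.byz : Set (Fin n)) (E.adversaryView τ t) m

/-- In the execution `τ` the honest nodes, too, send only messages that they are able to produce
with their own secret key from what they have received. -/
def Protocol.HonestFeasible {n ℓ : ℕ} (P : Protocol n ℓ) (E : Environment n ℓ) (τ : Trace n) :
    Prop :=
  ∀ t < P.rounds, ∀ u ∉ E.byz, ∀ p, ∀ m, τ t u p = some m →
    Derivable {u} (E.nodeView τ t u) m

/-- Every message that an honest node sends in `τ` has at most `b` bits. -/
def Protocol.Bandwidth {n ℓ : ℕ} (P : Protocol n ℓ) (E : Environment n ℓ) (sigLen : ℕ)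
    (τ : Trace n) (b : ℝ) : Prop :=
  ∀ t < P.rounds, ∀ u ∉ E.byz, ∀ p, ∀ m, τ t u p = some m → (m.size sigLen : ℝ) ≤ b

/-- The number of messages that honest nodes send in `τ`. -/
def Protocol.messageCount {n ℓ : ℕ} (P : Protocol n ℓ) (E : Environment n ℓ) (τ : Trace n) : ℕ :=
  ∑ t ∈ Finset.range P.rounds, ∑ u ∈ Finset.univ \ E.byz, ∑ p : Fin (n - 1),
    if (τ t u p).isSome then 1 else 0

/-- The decision of the node `u` after the last round. -/
def Protocol.decision {n ℓ : ℕ} (P : Protocol n ℓ) (E : Environment n ℓ) (ω : P.Coins)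
    (τ : Trace n) (u : Fin n) : Option (BitVec ℓ) :=
  P.decide (P.state E ω τ u P.rounds)

/-- (Explicit) Byzantine agreement is achieved. -/
structure Protocol.Agreement {n ℓ : ℕ} (P : Protocol n ℓ) (E : Environment n ℓ) (ω : P.Coins)
    (τ : Trace n) : Prop where
  termination : ∀ u ∉ E.byz, ∃ x, P.decision E ω τ u = some x
  consistency : ∀ u ∉ E.byz, ∀ v ∉ E.byz, P.decision E ω τ u = P.decision E ω τ v
  validity : ∀ x, (∀ u ∉ E.byz, E.input u = x) → ∀ u ∉ E.byz, P.decision E ω τ u = some x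

/-- A Byzantine adversary with its set of nodes, the inputs and the wiring already fixed. It may
choose the behaviour of the Byzantine nodes depending on all coin tosses of the execution, hence
on all states and messages of the honest nodes. -/
structure Adversary {n ℓ : ℕ} (P : Protocol n ℓ) (E : Environment n ℓ) where
  trace : P.Coins → Trace n
  isExecution : ∀ ω, P.IsExecution E ω (trace ω)

/-- Probability of an event for uniformly random coin tosses. -/
noncomputable def Protocol.prob {n ℓ : ℕ} (P : Protocol n ℓ) (event : P.Coins → Prop) : ℝ :=
  ({ω | event ω}.ncard : ℝ) / (Fintype.card P.Coins : ℝ)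

end AuthBA

/-! The global coin draws a committee of `k = Θ(log n)` seats, with repetition. The Byzantine set is
fixed before the coin is tossed and has density bounded away from 1/2, so by an exponential moment
bound (`card_majority_le`) it holds a minority of the seats except with probability at most `n ^
(-γ)`. Everything else is deterministic: if the honest seats are the majority, every execution
reaches agreement (`agreement`), however much the adversary knows about the coins.

The committee runs a variant of the Dolev–Strong protocol. Members sign and broadcast their inputs
as votes. A value is accepted at the end of round `t` if a majority of seats voted for it and at
least `t` seats have signed their acceptance; a new acceptance is broadcast with its evidence. The
vote majority contains an honest seat, which gives validity (`verdict_eq_input`). For consistency,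
an honest member that accepts before the end of round `k` adds its own signature, so that everybody
finds the value acceptable one round later (`acceptable_of_fresh`). An acceptance in round `k` needs
all `k` seats, hence an honest one that accepted earlier (`exists_timely_acceptance`). The verdict
is the unique accepted value or a default. Members broadcast signed verdicts, and all nodes follow
the majority of seats.

Two accepted values already force the default, so none beyond two are kept. A member thus broadcasts
at most four times, which gives at most `4 * k * n` messages in `k + 2` rounds. -/

namespace AuthBA

/-! ### Signatures contained in messages -/

/-- The pairs `(i, m)` such that the signature of `i` on `m` occurs in a message. -/
def Msg.signed {n : ℕ} : Msg n → Set (Fin n × Msg n)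
  | .data _ => ∅
  | .sig i m => insert (i, m) m.signed
  | .pair a b => a.signed ∪ b.signed

/-- A message can be taken apart down to any signature inside it. This is what entitles honest nodes
to forward evidence. -/
theorem Derivable.of_mem_signed {n : ℕ} {keys : Set (Fin n)} {known : Set (Msg n)} {m : Msg n}
    (h : Derivable keys known m) {s : Fin n × Msg n} (hs : s ∈ m.signed) :
    Derivable keys known (.sig s.1 s.2) := by
  induction m with
  | data l => simp [Msg.signed] at hs
  | sig i m ih =>
    rcases hs with rfl | hs
    · exact h
    · exact ih h.content hs
  | pair a b iha ihb =>
    rcases hs with hs | hs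
    · exact iha h.fst hs
    · exact ihb h.snd hs

theorem Derivable.mono {n : ℕ} {keys : Set (Fin n)} {known known' : Set (Msg n)} {m : Msg n}
    (h : Derivable keys known m) (hk : known ⊆ known') : Derivable keys known' m := by
  induction h with
  | seen h => exact .seen (hk h)
  | data l => exact .data l
  | pair _ _ iha ihb => exact .pair iha ihb
  | fst _ ih => exact .fst ih
  | snd _ ih => exact .snd ih
  | sign hi _ ih => exact .sign hi ih
  | content _ ih => exact .content ih

/-- Signatures under foreign keys can only be copied. -/
theorem Derivable.exists_seen_of_mem_signed {n : ℕ} {keys : Set (Fin n)} {known : Set (Msg n)}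
    {m : Msg n} (h : Derivable keys known m) {s : Fin n × Msg n} (hs : s ∈ m.signed)
    (hk : s.1 ∉ keys) : ∃ m' ∈ known, s ∈ m'.signed := by
  induction h with
  | seen h => exact ⟨_, h, hs⟩
  | data l => simp [Msg.signed] at hs
  | pair _ _ iha ihb =>
    rcases hs with hs | hs
    · exact iha hs
    · exact ihb hs
  | fst _ ih => exact ih (Or.inl hs)
  | snd _ ih => exact ih (Or.inr hs)
  | sign hi _ ih =>
    rcases hs with rfl | hs
    · exact absurd hi hk
    · exact ih hs
  | content _ ih => exact ih (Or.inr hs)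

/-- The concatenation of a list of messages. -/
def Msg.concat {n : ℕ} (L : List (Msg n)) : Msg n := L.foldr .pair (.data [])

theorem Msg.mem_signed_concat {n : ℕ} {L : List (Msg n)} {s : Fin n × Msg n} :
    s ∈ (Msg.concat L).signed ↔ ∃ m ∈ L, s ∈ m.signed := by
  induction L with
  | nil => simp [Msg.concat, Msg.signed]
  | cons a L ih =>
    have : (Msg.concat (a :: L)).signed = a.signed ∪ (Msg.concat L).signed := rfl
    rw [this, Set.mem_union, ih]
    simp

theorem Derivable.concat {n : ℕ} {keys : Set (Fin n)} {known : Set (Msg n)} {L : List (Msg n)}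
    (h : ∀ m ∈ L, Derivable keys known m) : Derivable keys known (Msg.concat L) := by
  induction L with
  | nil => exact .data []
  | cons a L ih =>
    exact .pair (h a (by simp)) (ih fun m hm => h m (by simp [hm]))

theorem Msg.size_concat_le {n σ b : ℕ} {L : List (Msg n)} (h : ∀ m ∈ L, m.size σ ≤ b) :
    (Msg.concat L).size σ ≤ L.length * (b + 1) + 1 := by
  induction L with
  | nil => simp [Msg.concat, Msg.size]
  | cons a L ih =>
    have e : (Msg.concat (a :: L)).size σ = a.size σ + (Msg.concat L).size σ + 1 := rfl
    have h1 := h a (by simp)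
    have h2 := ih fun m hm => h m (by simp [hm])
    rw [e, List.length_cons]
    linarith

/-! ### The committee protocol -/

/-- The three kinds of signed statements about a value: that it is the signer's input, that the
signer has accepted it, and that it is the outcome of the agreement within the committee. -/
inductive Phase
  | vote
  | accept
  | final

/-- Binary code of a phase. -/
def Phase.code : Phase → List Bool
  | .vote => [false, false]
  | .accept => [false, true]
  | .final => [true, true]

/-- The statement of kind `p` about the value `x`. -/
def ballot {n ℓ : ℕ} (p : Phase) (x : BitVec ℓ) : Msg n :=
  .data (p.code ++ List.ofFn fun i : Fin ℓ => x.getLsbD i)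

/-- All phase codes have the same length, so the code and the value can be separated. Hence a
signature made in one phase cannot serve in another. -/
theorem ballot_inj {n ℓ : ℕ} {p q : Phase} {x y : BitVec ℓ} :
    (ballot p x : Msg n) = ballot q y ↔ p = q ∧ x = y := by
  constructor
  · intro h
    simp only [ballot, Msg.data.injEq] at h
    have hl : p.code.length = q.code.length := by cases p <;> cases q <;> rfl
    obtain ⟨h1, h2⟩ := List.append_inj h hl
    refine ⟨by cases p <;> cases q <;> simp_all [Phase.code], ?_⟩
    have h3 := List.ofFn_injective h2
    apply BitVec.eq_of_getLsbD_eq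
    intro i hi
    exact congrFun h3 ⟨i, hi⟩
  · rintro ⟨rfl, rfl⟩
    rfl

theorem signed_sig_ballot {n ℓ : ℕ} (i : Fin n) (p : Phase) (x : BitVec ℓ) :
    (Msg.sig i (ballot p x)).signed = {(i, ballot p x)} := by
  simp [Msg.signed, ballot]

theorem size_sig_ballot {n ℓ : ℕ} (σ : ℕ) (i : Fin n) (p : Phase) (x : BitVec ℓ) :
    (Msg.sig i (ballot p x)).size σ = ℓ + 4 + Nat.clog 2 n + σ := by
  have : p.code.length = 2 := by cases p <;> rfl
  simp only [Msg.size, ballot, List.length_append, this, List.length_ofFn]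
  omega

/-- The cap of two bounds the traffic without affecting verdicts: the last clause says that an
element of `t` is dropped only when two others are present. -/
theorem exists_capped_union {α : Type*} [DecidableEq α] (s t : Finset α) :
    ∃ e : Finset α, s ⊆ e ∧ e ⊆ s ∪ t ∧ (s.card ≤ 2 → e.card ≤ 2) ∧ (t ⊆ e ∨ 2 ≤ e.card) := by
  by_cases h : (s ∪ t).card ≤ 2
  · exact ⟨s ∪ t, Finset.subset_union_left, subset_rfl, fun _ => h,
      Or.inl Finset.subset_union_right⟩
  · by_cases hs : s.card ≤ 2
    · obtain ⟨e, h1, h2, h3⟩ := Finset.exists_subsuperset_card_eq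
        (Finset.subset_union_left : s ⊆ s ∪ t) hs (by omega)
      exact ⟨e, h1, h2, fun _ => h3.le, Or.inr h3.ge⟩
    · exact ⟨s, subset_rfl, Finset.subset_union_left, fun h => h, Or.inr (by omega)⟩

open Classical in
/-- `s` enlarged by elements of `t` until all of `t` is included or there are two elements. -/
noncomputable def cappedUnion {α : Type*} (s t : Finset α) : Finset α :=
  (exists_capped_union s t).choose

/-- State of a node in the committee protocol: its identity and input, the holders of the `k`
committee seats, the number of the round, the signatures it has seen or produced, and the values it
has accepted, at most two; those in `fresh` were accepted in the last round. -/
structure CommitteeState (n ℓ k : ℕ) where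
  me : Fin n
  input : BitVec ℓ
  seat : Fin k → Fin n
  time : ℕ
  known : Set (Fin n × Msg n)
  accepted : Finset (BitVec ℓ)
  fresh : Finset (BitVec ℓ)

open Classical in
/-- The number of seats whose holders have, according to `known`, signed the statement of kind `p`
about `x`. -/
noncomputable def support {n ℓ k : ℕ} (seat : Fin k → Fin n) (known : Set (Fin n × Msg n))
    (p : Phase) (x : BitVec ℓ) : ℕ :=
  (Finset.univ.filter fun a => (seat a, ballot p x) ∈ known).card

namespace CommitteeState

open Classical in
/-- The known signatures of seat holders on the statement of kind `p` about `x`. -/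
noncomputable def evidence {n ℓ k : ℕ} (st : CommitteeState n ℓ k) (p : Phase) (x : BitVec ℓ) :
    List (Msg n) :=
  ((List.finRange k).filter fun a => decide ((st.seat a, ballot p x) ∈ st.known)).map
    fun a => .sig (st.seat a) (ballot p x)

/-- The node's acceptance of `x`, together with all that justifies it. -/
noncomputable def testimony {n ℓ k : ℕ} (st : CommitteeState n ℓ k) (x : BitVec ℓ) :
    List (Msg n) :=
  .sig st.me (ballot .accept x) :: (st.evidence .vote x ++ st.evidence .accept x)

open Classical in
/-- The accepted value if there is just one, and `0` otherwise. -/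
noncomputable def verdict {ℓ : ℕ} (acc : Finset (BitVec ℓ)) : BitVec ℓ :=
  if h : ∃ x, acc = {x} then h.choose else 0

open Classical in
/-- What the node sends to everybody. -/
noncomputable def out {n ℓ k : ℕ} (st : CommitteeState n ℓ k) : Option (Msg n) :=
  if st.me ∉ Set.range st.seat then none
  else if st.time = 0 then some (.sig st.me (ballot .vote st.input))
  else if st.time ≤ k then
    if st.fresh = ∅ then none else some (.concat (st.fresh.toList.flatMap st.testimony))
  else some (.sig st.me (ballot .final (verdict st.accepted)))

/-- All signatures in the messages that a node receives or sends in a round. -/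
noncomputable def learned {n ℓ k : ℕ} (st : CommitteeState n ℓ k)
    (msgs : Fin (n - 1) → Option (Msg n)) : Set (Fin n × Msg n) :=
  {s | (∃ q m, msgs q = some m ∧ s ∈ m.signed) ∨ ∃ m, st.out = some m ∧ s ∈ m.signed}

open Classical in
/-- The values for which more than half of the seats have voted and that have been accepted by
at least `t` seats. -/
noncomputable def acceptable {n ℓ k : ℕ} (seat : Fin k → Fin n) (known : Set (Fin n × Msg n))
    (t : ℕ) : Finset (BitVec ℓ) :=
  if t ≤ k then
    Finset.univ.filter fun x => k < 2 * support seat known .vote x ∧ t ≤ support seat known .accept x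
  else ∅

open Classical in
/-- State after a round. -/
noncomputable def next {n ℓ k : ℕ} (st : CommitteeState n ℓ k)
    (msgs : Fin (n - 1) → Option (Msg n)) : CommitteeState n ℓ k where
  me := st.me
  input := st.input
  seat := st.seat
  time := st.time + 1
  known := st.known ∪ st.learned msgs
  accepted := cappedUnion st.accepted
    (acceptable st.seat (st.known ∪ st.learned msgs) st.time)
  fresh := cappedUnion st.accepted
    (acceptable st.seat (st.known ∪ st.learned msgs) st.time) \ st.accepted

open Classical in
/-- The value on which more than half of the seats claim to have agreed. -/
noncomputable def outcome {n ℓ k : ℕ} (st : CommitteeState n ℓ k) : Option (BitVec ℓ) :=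
  if h : ∃ x : BitVec ℓ, k < 2 * support st.seat st.known .final x then some h.choose else none

end CommitteeState

/-- Agreement by a committee of `k` seats, which are assigned by the global coin. -/
noncomputable def committeeProtocol {n ℓ k c : ℕ} (seat : (Fin c → Bool) → Fin k → Fin n) :
    Protocol n ℓ where
  rounds := k + 2
  coinLen := c
  privLen := 0
  State := CommitteeState n ℓ k
  init u x r _ := ⟨u, x, seat r, 0, ∅, ∅, ∅⟩
  send st _ := st.out
  recv st msgs := st.next msgs
  decide st := st.outcome

/-! ### Behaviour of a single node -/

theorem cappedUnion_spec {α : Type*} [DecidableEq α] (s t : Finset α) :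
    s ⊆ cappedUnion s t ∧ cappedUnion s t ⊆ s ∪ t ∧
      (s.card ≤ 2 → (cappedUnion s t).card ≤ 2) ∧
      (t ⊆ cappedUnion s t ∨ 2 ≤ (cappedUnion s t).card) := by
  classical
  obtain ⟨h1, h2, h3, h4⟩ := (exists_capped_union s t).choose_spec
  have e : cappedUnion s t = (exists_capped_union s t).choose := by
    unfold cappedUnion
    -- The definition uses classical decidability of equality, the statement an arbitrary instance.
    congr!
  rw [e]
  exact ⟨h1, h2, h3, h4⟩

namespace CommitteeState

theorem mem_evidence {n ℓ k : ℕ} {st : CommitteeState n ℓ k} {p : Phase} {x : BitVec ℓ}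
    {m : Msg n} : m ∈ st.evidence p x ↔
      ∃ a, (st.seat a, ballot p x) ∈ st.known ∧ m = .sig (st.seat a) (ballot p x) := by
  simp [evidence, eq_comm]

theorem length_testimony_le {n ℓ k : ℕ} (st : CommitteeState n ℓ k) (x : BitVec ℓ) :
    (st.testimony x).length ≤ 2 * k + 1 := by
  classical
  have h (p : Phase) : (st.evidence p x).length ≤ k := by
    rw [evidence, List.length_map]
    exact (List.length_filter_le _ _).trans (by simp)
  have h1 := h .vote
  have h2 := h .accept
  simp only [testimony, List.length_cons, List.length_append]
  omega

/-- A node sends its vote, the reasons for its latest acceptances, or its verdict. -/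
theorem out_cases {n ℓ k : ℕ} {st : CommitteeState n ℓ k} {m : Msg n} (h : st.out = some m) :
    m = .sig st.me (ballot .vote st.input) ∨
    (m = .concat (st.fresh.toList.flatMap st.testimony)) ∨
    (k < st.time ∧ m = .sig st.me (ballot .final (verdict st.accepted))) := by
  unfold out at h
  split_ifs at h with h1 h2 h3 h4
  · exact Or.inl (Option.some.inj h).symm
  · exact Or.inr (Or.inl (Option.some.inj h).symm)
  · exact Or.inr (Or.inr ⟨by omega, (Option.some.inj h).symm⟩)

theorem mem_testimony {n ℓ k : ℕ} {st : CommitteeState n ℓ k} {x : BitVec ℓ} {m : Msg n} :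
    m ∈ st.testimony x ↔ m = .sig st.me (ballot .accept x) ∨
      ∃ p, (p = .vote ∨ p = .accept) ∧ ∃ a, (st.seat a, ballot p x) ∈ st.known ∧
        m = .sig (st.seat a) (ballot p x) := by
  simp only [testimony, List.mem_cons, List.mem_append, mem_evidence]
  constructor
  · rintro (h | h | h)
    · exact Or.inl h
    · exact Or.inr ⟨_, Or.inl rfl, h⟩
    · exact Or.inr ⟨_, Or.inr rfl, h⟩
  · rintro (h | ⟨p, rfl | rfl, h⟩)
    · exact Or.inl h
    · exact Or.inr (Or.inl h)
    · exact Or.inr (Or.inr h)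

/-- The statements that a node may sign for the first time. -/
def NewlySigns {n ℓ k : ℕ} (st : CommitteeState n ℓ k) (m : Msg n) : Prop :=
  m = ballot .vote st.input ∨ (∃ x ∈ st.fresh, m = ballot .accept x) ∨
    (k < st.time ∧ m = ballot .final (verdict st.accepted))

theorem mem_signed_out {n ℓ k : ℕ} {st : CommitteeState n ℓ k} {m : Msg n} (h : st.out = some m)
    {s : Fin n × Msg n} (hs : s ∈ m.signed) :
    s ∈ st.known ∨ (s.1 = st.me ∧ st.NewlySigns s.2) := by
  rcases out_cases h with rfl | rfl | ⟨hk, rfl⟩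
  · rw [signed_sig_ballot] at hs
    obtain rfl := hs
    exact Or.inr ⟨rfl, Or.inl rfl⟩
  · rw [Msg.mem_signed_concat] at hs
    obtain ⟨m, hm, hs⟩ := hs
    simp only [List.mem_flatMap, Finset.mem_toList] at hm
    obtain ⟨x, hx, hm⟩ := hm
    rcases mem_testimony.1 hm with rfl | ⟨p, -, a, ha, rfl⟩
    · rw [signed_sig_ballot] at hs
      obtain rfl := hs
      exact Or.inr ⟨rfl, Or.inr (Or.inl ⟨x, hx, rfl⟩)⟩
    · rw [signed_sig_ballot] at hs
      obtain rfl := hs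
      exact Or.inl ha
  · rw [signed_sig_ballot] at hs
    obtain rfl := hs
    exact Or.inr ⟨rfl, Or.inr (Or.inr ⟨hk, rfl⟩)⟩

/-- Everything sent is a concatenation of freshly made own signatures and copies of known ones. -/
theorem derivable_out {n ℓ k : ℕ} {st : CommitteeState n ℓ k} {m : Msg n} (h : st.out = some m)
    {V : Set (Msg n)} (hV : ∀ s ∈ st.known, Derivable {st.me} V (.sig s.1 s.2)) :
    Derivable {st.me} V m := by
  have own (p : Phase) (x : BitVec ℓ) : Derivable {st.me} V (.sig st.me (ballot p x)) :=
    .sign rfl (.data _)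
  rcases out_cases h with rfl | rfl | ⟨hk, rfl⟩
  · exact own _ _
  · refine Derivable.concat fun m hm => ?_
    simp only [List.mem_flatMap, Finset.mem_toList] at hm
    obtain ⟨x, hx, hm⟩ := hm
    rcases mem_testimony.1 hm with rfl | ⟨p, -, a, ha, rfl⟩
    · exact own _ _
    · exact hV _ ha
  · exact own _ _

theorem size_out_le {n ℓ k : ℕ} {st : CommitteeState n ℓ k} {m : Msg n} (h : st.out = some m)
    (hf : st.fresh.card ≤ 2) (σ : ℕ) :
    m.size σ ≤ 2 * (2 * k + 1) * (ℓ + 5 + Nat.clog 2 n + σ) + 1 := by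
  have single (i : Fin n) (p : Phase) (x : BitVec ℓ) :
      (Msg.sig i (ballot p x)).size σ ≤ 2 * (2 * k + 1) * (ℓ + 5 + Nat.clog 2 n + σ) + 1 := by
    rw [size_sig_ballot]
    nlinarith [Nat.zero_le (k * (ℓ + 5 + Nat.clog 2 n + σ))]
  rcases out_cases h with rfl | rfl | ⟨hk, rfl⟩
  · exact single _ _ _
  · refine (Msg.size_concat_le (b := ℓ + 4 + Nat.clog 2 n + σ) fun m hm => ?_).trans ?_
    · simp only [List.mem_flatMap, Finset.mem_toList] at hm
      obtain ⟨x, hx, hm⟩ := hm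
      rcases mem_testimony.1 hm with rfl | ⟨p, -, a, ha, rfl⟩ <;> rw [size_sig_ballot]
    · have hl : (st.fresh.toList.flatMap st.testimony).length ≤ 2 * (2 * k + 1) := by
        rw [List.length_flatMap]
        refine (List.sum_le_card_nsmul _ (2 * k + 1) ?_).trans ?_
        · simp only [List.mem_map]
          rintro _ ⟨x, -, rfl⟩
          exact st.length_testimony_le x
        · simp only [List.length_map, Finset.length_toList, smul_eq_mul]
          exact Nat.mul_le_mul_right _ hf
      have := Nat.mul_le_mul_right (ℓ + 5 + Nat.clog 2 n + σ) hl
      have e : ℓ + 4 + Nat.clog 2 n + σ + 1 = ℓ + 5 + Nat.clog 2 n + σ := by ring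
      rw [e]
      omega
  · exact single _ _ _

theorem verdict_singleton {ℓ : ℕ} (x : BitVec ℓ) : verdict {x} = x := by
  have h : ∃ y, ({x} : Finset (BitVec ℓ)) = {y} := ⟨x, rfl⟩
  rw [verdict, dif_pos h]
  exact (Finset.singleton_injective h.choose_spec).symm

theorem verdict_of_two_le {ℓ : ℕ} {acc : Finset (BitVec ℓ)} (h : 2 ≤ acc.card) :
    verdict acc = 0 := by
  rw [verdict, dif_neg]
  rintro ⟨x, rfl⟩
  simp at h

end CommitteeState

theorem support_mono {n ℓ k : ℕ} {seat : Fin k → Fin n} {known known' : Set (Fin n × Msg n)}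
    {p : Phase} {x : BitVec ℓ}
    (h : ∀ a, (seat a, ballot p x) ∈ known → (seat a, ballot p x) ∈ known') :
    support seat known p x ≤ support seat known' p x := by
  classical
  exact Finset.card_le_card fun a ha => by simpa using h a (by simpa using ha)

end AuthBA

/-! ### Evolution of the states in an execution -/

namespace AuthBA

section Execution

open CommitteeState

variable {n ℓ k c : ℕ} {seat : (Fin c → Bool) → Fin k → Fin n} {E : Environment n ℓ}
  {ω : (committeeProtocol (ℓ := ℓ) seat).Coins} {τ : Trace n}

variable (seat E ω τ) in
/-- The state of `u` before round `t`. -/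
noncomputable def nodeState (u : Fin n) (t : ℕ) : CommitteeState n ℓ k :=
  (committeeProtocol seat).state E ω τ u t

theorem nodeState_succ (u : Fin n) (t : ℕ) :
    nodeState seat E ω τ u (t + 1) = (nodeState seat E ω τ u t).next (E.received τ t u) := rfl

theorem nodeState_me (u : Fin n) (t : ℕ) : (nodeState seat E ω τ u t).me = u := by
  induction t with
  | zero => rfl
  | succ t ih => rw [nodeState_succ]; exact ih

theorem nodeState_input (u : Fin n) (t : ℕ) : (nodeState seat E ω τ u t).input = E.input u := by
  induction t with
  | zero => rfl
  | succ t ih => rw [nodeState_succ]; exact ih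

theorem nodeState_seat (u : Fin n) (t : ℕ) : (nodeState seat E ω τ u t).seat = seat ω.1 := by
  induction t with
  | zero => rfl
  | succ t ih => rw [nodeState_succ]; exact ih

theorem nodeState_time (u : Fin n) (t : ℕ) : (nodeState seat E ω τ u t).time = t := by
  induction t with
  | zero => rfl
  | succ t ih => rw [nodeState_succ]; exact congrArg (· + 1) ih

theorem known_succ (u : Fin n) (t : ℕ) : (nodeState seat E ω τ u (t + 1)).known =
    (nodeState seat E ω τ u t).known ∪ (nodeState seat E ω τ u t).learned (E.received τ t u) := rfl

theorem accepted_succ (u : Fin n) (t : ℕ) : (nodeState seat E ω τ u (t + 1)).accepted =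
    cappedUnion (nodeState seat E ω τ u t).accepted
      (acceptable (seat ω.1) (nodeState seat E ω τ u (t + 1)).known t) := by
  conv_rhs => rw [← nodeState_seat (seat := seat) (E := E) (ω := ω) (τ := τ) u t]
  conv_rhs => rw [← nodeState_time (seat := seat) (E := E) (ω := ω) (τ := τ) u t]
  rw [nodeState_time, nodeState_succ]
  simp only [next, nodeState_time]

theorem fresh_succ (u : Fin n) (t : ℕ) : (nodeState seat E ω τ u (t + 1)).fresh =
    (nodeState seat E ω τ u (t + 1)).accepted \ (nodeState seat E ω τ u t).accepted := by
  rw [nodeState_succ]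
  simp only [next]

theorem mem_acceptable {s : Fin k → Fin n} {K : Set (Fin n × Msg n)} {t : ℕ} {x : BitVec ℓ} :
    x ∈ acceptable s K t ↔
      t ≤ k ∧ k < 2 * support s K .vote x ∧ t ≤ support s K .accept x := by
  unfold acceptable
  split_ifs with h <;> simp [h]

theorem accepted_mono (u : Fin n) : Monotone fun t => (nodeState seat E ω τ u t).accepted := by
  refine monotone_nat_of_le_succ fun t => ?_
  rw [accepted_succ]
  exact (cappedUnion_spec _ _).1

theorem card_accepted_le (u : Fin n) (t : ℕ) : (nodeState seat E ω τ u t).accepted.card ≤ 2 := by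
  induction t with
  | zero => exact Nat.zero_le _
  | succ t ih =>
    rw [accepted_succ]
    exact (cappedUnion_spec _ _).2.2.1 ih

theorem fresh_subset (u : Fin n) (t : ℕ) :
    (nodeState seat E ω τ u t).fresh ⊆ (nodeState seat E ω τ u t).accepted := by
  cases t with
  | zero => exact subset_rfl
  | succ t => rw [fresh_succ]; exact Finset.sdiff_subset

theorem acceptable_of_mem_fresh {u : Fin n} {t : ℕ} {x : BitVec ℓ}
    (h : x ∈ (nodeState seat E ω τ u (t + 1)).fresh) :
    x ∉ (nodeState seat E ω τ u t).accepted ∧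
      x ∈ acceptable (seat ω.1) (nodeState seat E ω τ u (t + 1)).known t := by
  rw [fresh_succ, Finset.mem_sdiff] at h
  refine ⟨h.2, ?_⟩
  have h1 := h.1
  rw [accepted_succ] at h1
  exact (Finset.mem_union.1 ((cappedUnion_spec _ _).2.1 h1)).resolve_left h.2

theorem exists_fresh_of_mem_accepted {u : Fin n} {t : ℕ} {x : BitVec ℓ}
    (h : x ∈ (nodeState seat E ω τ u t).accepted) :
    ∃ s < t, x ∈ (nodeState seat E ω τ u (s + 1)).fresh := by
  induction t with
  | zero => exact absurd h (Finset.notMem_empty x)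
  | succ t ih =>
    by_cases h' : x ∈ (nodeState seat E ω τ u t).accepted
    · obtain ⟨s, hs, hx⟩ := ih h'
      exact ⟨s, by omega, hx⟩
    · exact ⟨t, by omega, by rw [fresh_succ]; exact Finset.mem_sdiff.2 ⟨h, h'⟩⟩

/-- The cap is the only obstacle to accepting an acceptable value, and acceptances are never
revoked. -/
theorem accepted_or_full {u : Fin n} {t T : ℕ} {x : BitVec ℓ} (hT : t < T)
    (h : x ∈ acceptable (seat ω.1) (nodeState seat E ω τ u (t + 1)).known t) :
    x ∈ (nodeState seat E ω τ u T).accepted ∨ 2 ≤ (nodeState seat E ω τ u T).accepted.card := by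
  have hm := accepted_mono (seat := seat) (E := E) (ω := ω) (τ := τ) u (show t + 1 ≤ T from hT)
  have hs := (cappedUnion_spec (nodeState seat E ω τ u t).accepted
    (acceptable (seat ω.1) (nodeState seat E ω τ u (t + 1)).known t)).2.2.2
  rw [← accepted_succ] at hs
  rcases hs with hs | hs
  · exact Or.inl (hm (hs h))
  · exact Or.inr (hs.trans (Finset.card_le_card hm))

/-! ### Feasibility, bandwidth and message complexity -/

theorem nodeView_mono (u : Fin n) {s t : ℕ} (h : s ≤ t) :
    E.nodeView τ s u ⊆ E.nodeView τ t u := by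
  rintro m ⟨r, hr, q, hq⟩
  exact ⟨r, by omega, q, hq⟩

/-- A node can produce all signatures that it knows. -/
theorem derivable_of_known (u : Fin n) (t : ℕ) :
    ∀ s ∈ (nodeState seat E ω τ u t).known,
      Derivable {u} (E.nodeView τ t u) (.sig s.1 s.2) := by
  induction t with
  | zero => exact fun s hs => absurd hs (Set.notMem_empty s)
  | succ t ih =>
    have ih' : ∀ s ∈ (nodeState seat E ω τ u t).known,
        Derivable {(nodeState seat E ω τ u t).me} (E.nodeView τ (t + 1) u) (.sig s.1 s.2) := by
      rw [nodeState_me]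
      exact fun s hs => (ih s hs).mono (nodeView_mono u (Nat.le_succ t))
    intro s hs
    rw [known_succ] at hs
    rcases hs with hs | ⟨q, m, hq, hs⟩ | ⟨m, ho, hs⟩
    · simpa only [nodeState_me] using ih' s hs
    · have hm : m ∈ E.nodeView τ (t + 1) u := ⟨t, Nat.lt_succ_self t, q, hq⟩
      exact (Derivable.seen hm).of_mem_signed hs
    · have := derivable_out ho ih'
      rw [nodeState_me] at this
      exact this.of_mem_signed hs

theorem trace_eq_out (hτ : (committeeProtocol seat).IsExecution E ω τ) {t : ℕ} (ht : t < k + 2)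
    {u : Fin n} (hu : u ∉ E.byz) (p : Fin (n - 1)) : τ t u p = (nodeState seat E ω τ u t).out :=
  hτ.honest t ht u hu p

theorem honestFeasible (hτ : (committeeProtocol seat).IsExecution E ω τ) :
    (committeeProtocol (ℓ := ℓ) seat).HonestFeasible E τ := by
  intro t ht u hu p m hm
  rw [trace_eq_out hτ ht hu] at hm
  have := derivable_out hm (V := E.nodeView τ t u)
    (by rw [nodeState_me]; exact derivable_of_known u t)
  rwa [nodeState_me] at this

theorem bandwidth (hτ : (committeeProtocol seat).IsExecution E ω τ) (σ : ℕ) :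
    (committeeProtocol (ℓ := ℓ) seat).Bandwidth E σ τ
      ((2 * (2 * k + 1) * (ℓ + 5 + Nat.clog 2 n + σ) + 1 : ℕ) : ℝ) := by
  intro t ht u hu p m hm
  rw [trace_eq_out hτ ht hu] at hm
  exact_mod_cast size_out_le hm ((Finset.card_le_card (fresh_subset u t)).trans
    (card_accepted_le u t)) σ

theorem sum_card_fresh (u : Fin n) (T : ℕ) :
    ∑ t ∈ Finset.range T, (nodeState seat E ω τ u (t + 1)).fresh.card
      = (nodeState seat E ω τ u T).accepted.card := by
  induction T with
  | zero => rfl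
  | succ T ih =>
    rw [Finset.sum_range_succ, ih, fresh_succ, add_comm]
    exact Finset.card_sdiff_add_card_eq_card (accepted_mono u (Nat.le_succ T))

/-- One broadcast for the vote, one for the verdict, and in between at most one per newly accepted
value, of which there are at most two. -/
theorem count_out_le (u : Fin n) :
    ∑ t ∈ Finset.range (k + 2), (if (nodeState seat E ω τ u t).out.isSome then 1 else 0)
      ≤ if u ∈ Set.range (seat ω.1) then 4 else 0 := by
  classical
  split_ifs with hu
  · rw [Finset.sum_range_succ, Finset.sum_range_succ']
    have h : ∑ t ∈ Finset.range k, (if (nodeState seat E ω τ u (t + 1)).out.isSome then 1 else 0)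
        ≤ ∑ t ∈ Finset.range k, (nodeState seat E ω τ u (t + 1)).fresh.card := by
      refine Finset.sum_le_sum fun t ht => ?_
      rw [Finset.mem_range] at ht
      split_ifs with hs
      · rw [Nat.one_le_iff_ne_zero, Finset.card_ne_zero, Finset.nonempty_iff_ne_empty]
        intro he
        simp [out, nodeState_time, he, show t + 1 ≤ k by omega] at hs
      · exact Nat.zero_le _
    rw [sum_card_fresh] at h
    have h2 := card_accepted_le (seat := seat) (E := E) (ω := ω) (τ := τ) u k
    split_ifs <;> omega
  · refine (Finset.sum_eq_zero fun t _ => if_neg ?_).le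
    simp only [out, nodeState_me, nodeState_seat, hu, not_false_eq_true, if_true]
    simp

theorem messageCount_le (hτ : (committeeProtocol seat).IsExecution E ω τ) :
    (committeeProtocol (ℓ := ℓ) seat).messageCount E τ ≤ 4 * k * n := by
  classical
  calc (committeeProtocol (ℓ := ℓ) seat).messageCount E τ
      = ∑ t ∈ Finset.range (k + 2), ∑ u ∈ Finset.univ \ E.byz,
          (n - 1) * (if (nodeState seat E ω τ u t).out.isSome then 1 else 0) := by
        unfold Protocol.messageCount
        refine Finset.sum_congr rfl fun t ht => Finset.sum_congr rfl fun u hu => ?_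
        have hu' : u ∉ E.byz := by simpa using hu
        rw [Finset.sum_congr rfl fun p _ => by
          rw [trace_eq_out hτ (Finset.mem_range.1 ht) hu' p]]
        simp
    _ = ∑ u ∈ Finset.univ \ E.byz, (n - 1) * ∑ t ∈ Finset.range (k + 2),
          (if (nodeState seat E ω τ u t).out.isSome then 1 else 0) := by
        rw [Finset.sum_comm]
        simp only [Finset.mul_sum]
    _ ≤ ∑ u : Fin n, n * (if u ∈ Set.range (seat ω.1) then 4 else 0) := by
        refine (Finset.sum_le_sum fun u _ => Nat.mul_le_mul (Nat.sub_le n 1) (count_out_le u)).trans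
          (Finset.sum_le_sum_of_subset (Finset.subset_univ _))
    _ = n * (4 * (Finset.univ.image (seat ω.1)).card) := by
        rw [← Finset.mul_sum, ← Finset.sum_filter, Finset.sum_const, smul_eq_mul, mul_comm _ 4]
        congr 3
        ext u
        simp
    _ ≤ n * (4 * k) := by
        gcongr
        simpa using Finset.card_image_le (s := Finset.univ) (f := seat ω.1)
    _ = 4 * k * n := by ring

/-! ### Unforgeability and its consequences -/

/-- Nobody knows a signature of an honest node before that node has produced it. -/
theorem newlySigns_of_known (hτ : (committeeProtocol seat).IsExecution E ω τ) {i : Fin n}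
    (hi : i ∉ E.byz) {m : Msg n} (t : ℕ) (ht : t ≤ k + 2) :
    ∀ v ∉ E.byz, (i, m) ∈ (nodeState seat E ω τ v t).known →
      ∃ s < t, (nodeState seat E ω τ i s).NewlySigns m := by
  induction t using Nat.strong_induction_on with
  | _ t ih =>
  cases t with
  | zero => exact fun v _ h => absurd h (Set.notMem_empty _)
  | succ t =>
    -- A rushing adversary may copy from any honest message up to and including round `t`, so honest
    -- messages of all these rounds are treated at once; this is why the induction is strong.
    have honest_out : ∀ s ≤ t, ∀ v ∉ E.byz, ∀ m', (nodeState seat E ω τ v s).out = some m' →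
        (i, m) ∈ m'.signed → ∃ r < t + 1, (nodeState seat E ω τ i r).NewlySigns m := by
      intro s hs v hv m' ho hm
      rcases mem_signed_out ho hm with hk | ⟨he, hn⟩
      · obtain ⟨r, hr, h⟩ := ih s (by omega) (by omega) v hv hk
        exact ⟨r, by omega, h⟩
      · rw [nodeState_me] at he
        obtain rfl : i = v := he
        exact ⟨s, by omega, hn⟩
    rintro v hv (hs | ⟨q, m', hq, hs⟩ | ⟨m', ho, hs⟩)
    · obtain ⟨r, hr, h⟩ := ih t (by omega) (by omega) v hv hs
      exact ⟨r, by omega, h⟩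
    · by_cases hw : (E.port v q : Fin n) ∈ E.byz
      · obtain ⟨m'', ⟨r, hr, u, hu, p, hp⟩, hs'⟩ :=
          (hτ.unforgeable t ht _ hw _ m' hq).exists_seen_of_mem_signed hs (by simpa using hi)
        rw [trace_eq_out hτ (by omega) hu] at hp
        exact honest_out r hr u hu m'' hp hs'
      · have hq' : (nodeState seat E ω τ (E.port v q) t).out = some m' := by
          rw [← trace_eq_out hτ (by omega) hw]
          exact hq
        exact honest_out t le_rfl _ hw m' hq' hs
    · exact honest_out t le_rfl v hv m' ho hs

theorem eq_input_of_vote (hτ : (committeeProtocol seat).IsExecution E ω τ) {i v : Fin n}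
    (hi : i ∉ E.byz) (hv : v ∉ E.byz) {x : BitVec ℓ} {t : ℕ} (ht : t ≤ k + 2)
    (h : (i, ballot .vote x) ∈ (nodeState seat E ω τ v t).known) : x = E.input i := by
  obtain ⟨s, -, h | ⟨y, -, h⟩ | ⟨-, h⟩⟩ := newlySigns_of_known hτ hi t ht v hv h
  · rw [nodeState_input] at h
    exact (ballot_inj.1 h).2
  · cases (ballot_inj.1 h).1
  · cases (ballot_inj.1 h).1

theorem exists_fresh_of_accept (hτ : (committeeProtocol seat).IsExecution E ω τ) {i v : Fin n}
    (hi : i ∉ E.byz) (hv : v ∉ E.byz) {x : BitVec ℓ} {t : ℕ} (ht : t ≤ k + 2)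
    (h : (i, ballot .accept x) ∈ (nodeState seat E ω τ v t).known) :
    ∃ s < t, x ∈ (nodeState seat E ω τ i s).fresh := by
  obtain ⟨s, hs, h | ⟨y, hy, h⟩ | ⟨-, h⟩⟩ := newlySigns_of_known hτ hi t ht v hv h
  · cases (ballot_inj.1 h).1
  · obtain rfl := (ballot_inj.1 h).2
    exact ⟨s, hs, hy⟩
  · cases (ballot_inj.1 h).1

/-- Verdicts are signed only after time `k`, and the signature is known before round `k + 2`; this
leaves exactly time `k + 1`. -/
theorem eq_verdict_of_final (hτ : (committeeProtocol seat).IsExecution E ω τ) {i v : Fin n}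
    (hi : i ∉ E.byz) (hv : v ∉ E.byz) {x : BitVec ℓ}
    (h : (i, ballot .final x) ∈ (nodeState seat E ω τ v (k + 2)).known) :
    x = verdict (nodeState seat E ω τ i (k + 1)).accepted := by
  obtain ⟨s, hs, h | ⟨y, -, h⟩ | ⟨hk, h⟩⟩ := newlySigns_of_known hτ hi _ le_rfl v hv h
  · cases (ballot_inj.1 h).1
  · cases (ballot_inj.1 h).1
  · rw [nodeState_time] at hk
    obtain rfl : s = k + 1 := by omega
    exact (ballot_inj.1 h).2

/-! ### Delivery of honest messages -/

/-- Messages of honest nodes reach everybody. -/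
theorem known_of_out (hτ : (committeeProtocol seat).IsExecution E ω τ) {i : Fin n}
    (hi : i ∉ E.byz) {t : ℕ} (ht : t < k + 2) {m : Msg n}
    (ho : (nodeState seat E ω τ i t).out = some m) (v : Fin n) :
    m.signed ⊆ (nodeState seat E ω τ v (t + 1)).known := by
  intro s hs
  right
  -- No port leads from a node to itself; its own signatures enter through the second clause of
  -- `learned`.
  by_cases hiv : i = v
  · subst hiv
    exact Or.inr ⟨m, ho, hs⟩
  · refine Or.inl ⟨(E.port v).symm ⟨i, hiv⟩, m, ?_, hs⟩
    have e : (E.port v ((E.port v).symm ⟨i, hiv⟩) : Fin n) = i := by simp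
    have h : ∀ w p, w = i → τ t w p = some m := by
      rintro w p rfl
      rw [trace_eq_out hτ ht hi, ho]
    exact h _ _ e

theorem known_vote (hτ : (committeeProtocol seat).IsExecution E ω τ) {i : Fin n}
    (hi : i ∉ E.byz) (hm : i ∈ Set.range (seat ω.1)) (v : Fin n) :
    (i, ballot .vote (E.input i)) ∈ (nodeState seat E ω τ v 1).known := by
  have ho : (nodeState seat E ω τ i 0).out = some (.sig i (ballot .vote (E.input i))) := by
    simp [out, nodeState_me, nodeState_seat, nodeState_time, nodeState_input, hm]
  exact known_of_out hτ hi (by omega) ho v (by rw [signed_sig_ballot]; rfl)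

theorem known_final (hτ : (committeeProtocol seat).IsExecution E ω τ) {i : Fin n}
    (hi : i ∉ E.byz) (hm : i ∈ Set.range (seat ω.1)) (v : Fin n) :
    (i, ballot .final (verdict (nodeState seat E ω τ i (k + 1)).accepted)) ∈
      (nodeState seat E ω τ v (k + 2)).known := by
  have ho : (nodeState seat E ω τ i (k + 1)).out =
      some (.sig i (ballot .final (verdict (nodeState seat E ω τ i (k + 1)).accepted))) := by
    simp [out, nodeState_me, nodeState_seat, nodeState_time, hm]
  exact known_of_out hτ hi (by omega) ho v (by rw [signed_sig_ballot]; rfl)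

theorem known_testimony (hτ : (committeeProtocol seat).IsExecution E ω τ) {i : Fin n}
    (hi : i ∉ E.byz) (hm : i ∈ Set.range (seat ω.1)) {t : ℕ} (ht : t < k) {x : BitVec ℓ}
    (hx : x ∈ (nodeState seat E ω τ i (t + 1)).fresh) (v : Fin n) :
    (i, ballot .accept x) ∈ (nodeState seat E ω τ v (t + 2)).known ∧
    ∀ p, p = .vote ∨ p = .accept → ∀ a,
      (seat ω.1 a, ballot p x) ∈ (nodeState seat E ω τ i (t + 1)).known →
      (seat ω.1 a, ballot p x) ∈ (nodeState seat E ω τ v (t + 2)).known := by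
  have ho : (nodeState seat E ω τ i (t + 1)).out =
      some (.concat ((nodeState seat E ω τ i (t + 1)).fresh.toList.flatMap
        (nodeState seat E ω τ i (t + 1)).testimony)) := by
    simp [out, nodeState_me, nodeState_seat, nodeState_time, hm, Finset.ne_empty_of_mem hx,
      show t + 1 ≤ k by omega]
  have key (m : Msg n) (hmt : m ∈ (nodeState seat E ω τ i (t + 1)).testimony x) :
      m.signed ⊆ (nodeState seat E ω τ v (t + 2)).known := by
    refine subset_trans (fun s hs => ?_) (known_of_out hτ hi (by omega) ho v)
    rw [Msg.mem_signed_concat]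
    exact ⟨m, List.mem_flatMap.2 ⟨x, Finset.mem_toList.2 hx, hmt⟩, hs⟩
  constructor
  · refine key (.sig i (ballot .accept x)) (mem_testimony.2 (Or.inl ?_))
      (by rw [signed_sig_ballot]; rfl)
    rw [nodeState_me]
  · intro p hp a ha
    refine key (.sig (seat ω.1 a) (ballot p x)) (mem_testimony.2 (Or.inr ⟨p, hp, a, ?_, ?_⟩))
      (by rw [signed_sig_ballot]; rfl)
    · rwa [nodeState_seat]
    · rw [nodeState_seat]

/-- A value that an honest member accepts in time is acceptable to every honest node one round
later. -/
theorem acceptable_of_fresh (hτ : (committeeProtocol seat).IsExecution E ω τ) {i : Fin n}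
    (hi : i ∉ E.byz) (hm : i ∈ Set.range (seat ω.1)) {t : ℕ} (ht : t < k) {x : BitVec ℓ}
    (hx : x ∈ (nodeState seat E ω τ i (t + 1)).fresh) (v : Fin n) :
    x ∈ acceptable (seat ω.1) (nodeState seat E ω τ v (t + 2)).known (t + 1) := by
  classical
  obtain ⟨hnew, hacc⟩ := acceptable_of_mem_fresh hx
  rw [mem_acceptable] at hacc ⊢
  obtain ⟨hown, hev⟩ := known_testimony hτ hi hm ht hx v
  refine ⟨ht, ?_, ?_⟩
  · have := support_mono (hev .vote (Or.inl rfl))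
    omega
  · refine Nat.succ_le_of_lt (hacc.2.2.trans_lt (Finset.card_lt_card ?_))
    rw [Finset.ssubset_iff_of_subset]
    · obtain ⟨a, rfl⟩ := hm
      -- The seat of `i` is a genuinely new supporter: had its acceptance been signed before, `x`
      -- would have been accepted by time `t` and would not be fresh.
      refine ⟨a, by simpa using hown, ?_⟩
      intro ha
      have ha' : (seat ω.1 a, ballot .accept x) ∈
          (nodeState seat E ω τ (seat ω.1 a) (t + 1)).known := by simpa using ha
      obtain ⟨s, hs, hf⟩ := exists_fresh_of_accept hτ hi hi (by omega) ha'
      exact hnew (accepted_mono _ (Nat.le_of_lt_succ hs) (fresh_subset _ _ hf))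
    · intro a ha
      have := hev .accept (Or.inr rfl) a (by simpa using ha)
      simpa using this

/-! ### Agreement under an honest majority of seats -/

/-- The Byzantine nodes hold a minority of the seats. -/
def HonestMajority (E : Environment n ℓ) (s : Fin k → Fin n) : Prop :=
  2 * (Finset.univ.filter fun a => s a ∈ E.byz).card < k

theorem card_honest_add (E : Environment n ℓ) (s : Fin k → Fin n) :
    (Finset.univ.filter fun a => s a ∈ E.byz).card +
      (Finset.univ.filter fun a => s a ∉ E.byz).card = k := by
  simpa using Finset.card_filter_add_card_filter_not (s := Finset.univ) (fun a => s a ∈ E.byz)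

theorem HonestMajority.exists_honest {s : Fin k → Fin n} (h : HonestMajority E s)
    {K : Set (Fin n × Msg n)} {p : Phase} {x : BitVec ℓ} (hx : k < 2 * support s K p x) :
    ∃ a, s a ∉ E.byz ∧ (s a, ballot p x) ∈ K := by
  classical
  by_contra! hc
  have : support s K p x ≤ (Finset.univ.filter fun a => s a ∈ E.byz).card := by
    refine Finset.card_le_card fun a ha => ?_
    have ha' : (s a, ballot p x) ∈ K := by simpa using ha
    by_contra hb
    exact hc a (by simpa using hb) ha'
  unfold HonestMajority at h
  omega

theorem HonestMajority.support_of_honest {s : Fin k → Fin n} (h : HonestMajority E s)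
    {K : Set (Fin n × Msg n)} {p : Phase} {x : BitVec ℓ}
    (hx : ∀ a, s a ∉ E.byz → (s a, ballot p x) ∈ K) : k < 2 * support s K p x := by
  classical
  have h1 : (Finset.univ.filter fun a => s a ∉ E.byz).card ≤ support s K p x :=
    Finset.card_le_card fun a ha => by simpa using hx a (by simpa using ha)
  have h2 := card_honest_add E s
  unfold HonestMajority at h
  omega

/-- Acceptance in the last possible round `k` requires signatures of all seats; an honest one among
them was given upon an earlier acceptance, early enough to be passed on. -/
theorem exists_timely_acceptance (hτ : (committeeProtocol seat).IsExecution E ω τ)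
    (hg : HonestMajority E (seat ω.1)) {i : Fin n} (hi : i ∉ E.byz)
    (hm : i ∈ Set.range (seat ω.1)) {x : BitVec ℓ}
    (hx : x ∈ (nodeState seat E ω τ i (k + 1)).accepted) :
    ∃ j ∉ E.byz, j ∈ Set.range (seat ω.1) ∧ ∃ t < k, x ∈ (nodeState seat E ω τ j (t + 1)).fresh := by
  obtain ⟨s, hs, hf⟩ := exists_fresh_of_mem_accepted hx
  by_cases hsk : s < k
  · exact ⟨i, hi, hm, s, hsk, hf⟩
  · obtain rfl : s = k := by omega
    obtain ⟨-, -, hacc⟩ := mem_acceptable.1 (acceptable_of_mem_fresh hf).2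
    have hk : 0 < s := by unfold HonestMajority at hg; omega
    obtain ⟨a, ha, hka⟩ := hg.exists_honest
      (show s < 2 * support _ (nodeState seat E ω τ i (s + 1)).known Phase.accept x by omega)
    obtain ⟨r, hr, hfr⟩ := exists_fresh_of_accept hτ ha hi (Nat.le_succ (s + 1)) hka
    -- Nothing is fresh at time `0`, so the earlier acceptance can be indexed as `r' + 1 ≤ k`.
    obtain ⟨r', hr', hf'⟩ := exists_fresh_of_mem_accepted
      (fresh_subset (seat ω.1 a) r hfr)
    exact ⟨_, ha, ⟨a, rfl⟩, r', by omega, hf'⟩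

theorem accepted_subset_or_full (hτ : (committeeProtocol seat).IsExecution E ω τ)
    (hg : HonestMajority E (seat ω.1)) {i j : Fin n} (hi : i ∉ E.byz)
    (hm : i ∈ Set.range (seat ω.1)) :
    (nodeState seat E ω τ i (k + 1)).accepted ⊆ (nodeState seat E ω τ j (k + 1)).accepted ∨
      2 ≤ (nodeState seat E ω τ j (k + 1)).accepted.card := by
  rw [or_iff_not_imp_right]
  intro hc x hx
  obtain ⟨l, hl, hml, t, ht, hf⟩ := exists_timely_acceptance hτ hg hi hm hx
  exact (accepted_or_full (by omega) (acceptable_of_fresh hτ hl hml ht hf j)).resolve_right hc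

/-- If neither member is full, both inclusions hold and the sets coincide. If one is full, so is the
other, and both verdicts are the default. -/
theorem verdict_eq (hτ : (committeeProtocol seat).IsExecution E ω τ)
    (hg : HonestMajority E (seat ω.1)) {i j : Fin n} (hi : i ∉ E.byz) (hj : j ∉ E.byz)
    (hmi : i ∈ Set.range (seat ω.1)) (hmj : j ∈ Set.range (seat ω.1)) :
    verdict (nodeState seat E ω τ i (k + 1)).accepted =
      verdict (nodeState seat E ω τ j (k + 1)).accepted := by
  have hij := accepted_subset_or_full hτ hg (j := j) hi hmi
  have hji := accepted_subset_or_full hτ hg (j := i) hj hmj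
  by_cases ci : 2 ≤ (nodeState seat E ω τ i (k + 1)).accepted.card <;>
    by_cases cj : 2 ≤ (nodeState seat E ω τ j (k + 1)).accepted.card
  · rw [verdict_of_two_le ci, verdict_of_two_le cj]
  · exact absurd (ci.trans (Finset.card_le_card (hij.resolve_right cj))) cj
  · exact absurd (cj.trans (Finset.card_le_card (hji.resolve_right ci))) ci
  · rw [(hij.resolve_right cj).antisymm (hji.resolve_right ci)]

theorem verdict_eq_input (hτ : (committeeProtocol seat).IsExecution E ω τ)
    (hg : HonestMajority E (seat ω.1)) {x : BitVec ℓ} (hx : ∀ u ∉ E.byz, E.input u = x)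
    {i : Fin n} (hi : i ∉ E.byz) :
    verdict (nodeState seat E ω τ i (k + 1)).accepted = x := by
  have hsub : (nodeState seat E ω τ i (k + 1)).accepted ⊆ {x} := by
    intro y hy
    obtain ⟨t, ht, hf⟩ := exists_fresh_of_mem_accepted hy
    have hacc := mem_acceptable.1 (acceptable_of_mem_fresh hf).2
    obtain ⟨a, ha, hka⟩ := hg.exists_honest hacc.2.1
    rw [Finset.mem_singleton, eq_input_of_vote hτ ha hi (by omega) hka, hx _ ha]
  have hmem : x ∈ (nodeState seat E ω τ i (k + 1)).accepted := by
    -- At the end of round `0` no acceptances are required, so the honest votes alone suffice.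
    refine (accepted_or_full (t := 0) (by omega) (mem_acceptable.2
      ⟨Nat.zero_le _, ?_, Nat.zero_le _⟩)).resolve_right fun h => ?_
    · refine hg.support_of_honest fun a ha => ?_
      rw [← hx _ ha]
      exact known_vote hτ ha ⟨a, rfl⟩ i
    · have := h.trans (Finset.card_le_card hsub)
      simp at this
  rw [hsub.antisymm (Finset.singleton_subset_iff.2 hmem), verdict_singleton]

theorem agreement (hτ : (committeeProtocol seat).IsExecution E ω τ)
    (hg : HonestMajority E (seat ω.1)) :
    (committeeProtocol (ℓ := ℓ) seat).Agreement E ω τ := by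
  -- Strictness of the minority excludes `k = 0`, so some seat is honest; its verdict is the common
  -- outcome.
  obtain ⟨b, hb⟩ : ∃ b, seat ω.1 b ∉ E.byz := by
    by_contra! hc
    unfold HonestMajority at hg
    simp [hc] at hg
    omega
  have hd (v : Fin n) (hv : v ∉ E.byz) : (committeeProtocol (ℓ := ℓ) seat).decision E ω τ v =
      some (verdict (nodeState seat E ω τ (seat ω.1 b) (k + 1)).accepted) := by
    have hmaj : k < 2 * support (seat ω.1) (nodeState seat E ω τ v (k + 2)).known .final
        (verdict (nodeState seat E ω τ (seat ω.1 b) (k + 1)).accepted) :=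
      hg.support_of_honest fun a ha => by
        rw [← verdict_eq hτ hg ha hb ⟨a, rfl⟩ ⟨b, rfl⟩]
        exact known_final hτ ha ⟨a, rfl⟩ v
    change (nodeState seat E ω τ v (k + 2)).outcome = _
    have hex : ∃ x : BitVec ℓ, k < 2 * support (nodeState seat E ω τ v (k + 2)).seat
        (nodeState seat E ω τ v (k + 2)).known .final x := by
      rw [nodeState_seat]
      exact ⟨_, hmaj⟩
    rw [outcome, dif_pos hex, Option.some.injEq]
    have hch := hex.choose_spec
    -- Whatever value is chosen, an honest seat signed it as its verdict; so the choice is unique.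
    generalize hex.choose = y at hch
    rw [nodeState_seat] at hch
    obtain ⟨a, ha, hka⟩ := hg.exists_honest hch
    rw [eq_verdict_of_final hτ ha hv hka]
    exact verdict_eq hτ hg ha hb ⟨a, rfl⟩ ⟨b, rfl⟩
  refine ⟨fun u hu => ⟨_, hd u hu⟩, fun u hu v hv => by rw [hd u hu, hd v hv], fun x hx u hu => ?_⟩
  rw [hd u hu, verdict_eq_input hτ hg hx hb]

end Execution

end AuthBA

/-! ### Drawing the committee -/

namespace AuthBA

/-- Among `k` independent uniform samples from `V`, those from a set of density at most `1 / 2 - δ`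
are the majority with probability at most `(1 - δ ^ 2) ^ k`. -/
theorem card_majority_le {V : Type*} [Fintype V] [DecidableEq V] (bad : Finset V) (k : ℕ) {δ : ℝ}
    (hδ : 0 < δ) (hbad : (bad.card : ℝ) ≤ (1 / 2 - δ) * Fintype.card V) :
    ((Finset.univ.filter fun f : Fin k → V =>
        k ≤ 2 * (Finset.univ.filter fun a => f a ∈ bad).card).card : ℝ) ≤
      (1 - δ ^ 2) ^ k * Fintype.card (Fin k → V) := by
  -- Exponential moment: each bad sample has weight `w ^ 2`, so a bad majority has product at least
  -- `w ^ k`. With `w = 1 + δ` the mean weight is at most `w * (1 - δ ^ 2)`, with slack `δ ^ 2 / 2`.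
  set w : ℝ := 1 + δ with hw
  have hw1 : 1 ≤ w := by linarith
  have hw0 : 0 < w ^ k := by positivity
  set g : V → ℝ := fun v => if v ∈ bad then w ^ 2 else 1 with hg
  have hg0 : ∀ v, 0 ≤ g v := fun v => by simp only [hg]; split_ifs <;> positivity
  have hprod (f : Fin k → V) :
      ∏ a, g (f a) = w ^ (2 * (Finset.univ.filter fun a => f a ∈ bad).card) := by
    simp only [hg]
    rw [Finset.prod_ite, Finset.prod_const, Finset.prod_const_one, mul_one, ← pow_mul]
  have hsum : ∑ v, g v ≤ w * ((1 - δ ^ 2) * Fintype.card V) := by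
    have e : ∑ v, g v = Fintype.card V + (w ^ 2 - 1) * bad.card := by
      have h (v : V) : g v = 1 + (w ^ 2 - 1) * (if v ∈ bad then 1 else 0) := by
        simp only [hg]; split_ifs <;> ring
      simp_rw [h]
      rw [Finset.sum_add_distrib, ← Finset.mul_sum]
      simp
    have h1 : (w ^ 2 - 1) * bad.card ≤ (w ^ 2 - 1) * ((1 / 2 - δ) * Fintype.card V) :=
      mul_le_mul_of_nonneg_left hbad (by nlinarith)
    have h2 : 0 ≤ δ ^ 2 * (Fintype.card V : ℝ) := by positivity
    rw [e]
    rw [hw] at h1 ⊢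
    linarith
  have hmarkov : ((Finset.univ.filter fun f : Fin k → V =>
      k ≤ 2 * (Finset.univ.filter fun a => f a ∈ bad).card).card : ℝ) * w ^ k ≤
      (∑ v, g v) ^ k := by
    rw [Fintype.sum_pow, ← nsmul_eq_mul]
    refine (Finset.card_nsmul_le_sum _ (fun f : Fin k → V => ∏ a, g (f a)) _ fun f hf => ?_).trans
      (Finset.sum_le_sum_of_subset_of_nonneg (Finset.filter_subset _ _)
        fun f _ _ => Finset.prod_nonneg fun a _ => hg0 _)
    rw [hprod]
    exact pow_le_pow_right₀ hw1 (by simpa using hf)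
  have h := hmarkov.trans (pow_le_pow_left₀ (Finset.sum_nonneg fun v _ => hg0 v) hsum k)
  rw [mul_pow, mul_comm (w ^ k)] at h
  have h' := le_of_mul_le_mul_right h hw0
  rwa [mul_pow, ← Nat.cast_pow, ← Fintype.card_fin k, ← Fintype.card_fun, Fintype.card_fin] at h'

/-- `k` blocks of `b` coin tosses, read as binary numbers. -/
def blocks (k b : ℕ) : (Fin (k * b) → Bool) ≃ (Fin k → Fin (2 ^ b)) :=
  ((finProdFinEquiv.symm.arrowCongr finTwoEquiv.symm).trans (Equiv.curry _ _ _)).trans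
    ((Equiv.refl _).arrowCongr finFunctionFinEquiv)

/-- The holder of each of `k` seats, drawn with `b` coin tosses. -/
def drawSeats {n : ℕ} (hn : 0 < n) (k b : ℕ) (r : Fin (k * b) → Bool) (a : Fin k) : Fin n :=
  ⟨blocks k b r a % n, Nat.mod_lt _ hn⟩

/-- A number is determined by its residue and quotient modulo `n`, and only `N / n + 1` quotients
occur. -/
theorem card_residues_le {n : ℕ} (hn : 0 < n) (N : ℕ) (s : Finset (Fin n)) :
    (Finset.univ.filter fun v : Fin N => (⟨v % n, Nat.mod_lt _ hn⟩ : Fin n) ∈ s).card ≤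
      s.card * (N / n + 1) := by
  rw [← Finset.card_range (N / n + 1), ← Finset.card_product]
  refine Finset.card_le_card_of_injOn
    (fun v => ((⟨v % n, Nat.mod_lt _ hn⟩ : Fin n), (v : ℕ) / n)) ?_ ?_
  · intro v hv
    simp only [Finset.coe_filter, Finset.mem_univ, true_and, Set.mem_ofPred_eq] at hv
    simp only [Finset.coe_product, Set.mem_prod, Finset.mem_coe, Finset.mem_range]
    exact ⟨hv, Nat.lt_succ_of_le (Nat.div_le_div_right v.2.le)⟩
  · intro v _ v' _ h
    simp only [Prod.mk.injEq, Fin.mk.injEq] at h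
    apply Fin.ext
    rw [← Nat.mod_add_div v n, ← Nat.mod_add_div v' n, h.1, h.2]

/-- Of the margin `2 * δ`, one `δ` absorbs the bias of reduction modulo `n` and the other drives the
tail bound. -/
theorem card_not_honestMajority_le {n ℓ : ℕ} (hn : 0 < n) (k b : ℕ) (E : Environment n ℓ) {δ : ℝ}
    (hδ : 0 < δ) (hb : (n : ℝ) ≤ δ * 2 ^ b) (hE : (E.byz.card : ℝ) ≤ (1 / 2 - 2 * δ) * n) :
    ({r | ¬ HonestMajority E (drawSeats hn k b r)}.ncard : ℝ) ≤
      (1 - δ ^ 2) ^ k * Fintype.card (Fin (k * b) → Bool) := by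
  classical
  set bad := Finset.univ.filter
    fun v : Fin (2 ^ b) => (⟨v % n, Nat.mod_lt _ hn⟩ : Fin n) ∈ E.byz with hbad
  have hn' : (0 : ℝ) < n := by exact_mod_cast hn
  have hcard : (bad.card : ℝ) ≤ (1 / 2 - δ) * Fintype.card (Fin (2 ^ b)) := by
    have h1 : (bad.card : ℝ) ≤ E.byz.card * ((2 ^ b / n : ℕ) + 1) := by
      exact_mod_cast card_residues_le hn (2 ^ b) E.byz
    have h2 : (((2 ^ b / n : ℕ)) : ℝ) ≤ 2 ^ b / n := by
      exact_mod_cast Nat.cast_div_le (α := ℝ) (m := 2 ^ b) (n := n)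
    have h3 : (E.byz.card : ℝ) ≤ n := by
      exact_mod_cast (Finset.card_le_univ E.byz).trans_eq (Fintype.card_fin n)
    have h4 : (E.byz.card : ℝ) * (2 ^ b / n) ≤ (1 / 2 - 2 * δ) * n * (2 ^ b / n) :=
      mul_le_mul_of_nonneg_right hE (by positivity)
    have h5 : (1 / 2 - 2 * δ) * n * (2 ^ b / n) = (1 / 2 - 2 * δ) * 2 ^ b := by
      field_simp
    have h6 : (E.byz.card : ℝ) * ((2 ^ b / n : ℕ) + 1) ≤ E.byz.card * (2 ^ b / n) + n := by
      nlinarith [mul_le_mul_of_nonneg_left h2 (Nat.cast_nonneg (α := ℝ) E.byz.card)]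
    rw [Fintype.card_fin, Nat.cast_pow, Nat.cast_ofNat]
    linarith
  have hset : {r | ¬ HonestMajority E (drawSeats hn k b r)} = blocks k b ⁻¹'
      ↑(Finset.univ.filter fun f : Fin k → Fin (2 ^ b) =>
        k ≤ 2 * (Finset.univ.filter fun a => f a ∈ bad).card) := by
    ext r
    simp [HonestMajority, drawSeats, hbad]
    congr!
  rw [hset, Set.ncard_preimage_of_injective_subset_range (blocks k b).injective
    (by rw [(blocks k b).surjective.range_eq]; exact Set.subset_univ _), Set.ncard_coe_finset,
    Fintype.card_congr (blocks k b)]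
  exact card_majority_le bad k hδ hcard

/-- Only the global coin has to be favourable; private coins contribute a common factor to both
counts. -/
theorem le_prob_of_fst {n ℓ : ℕ} (P : Protocol n ℓ) {good : (Fin P.coinLen → Bool) → Prop}
    {event : P.Coins → Prop} (h : ∀ ω, good ω.1 → event ω) {q : ℝ}
    (hq : ({r | ¬ good r}.ncard : ℝ) ≤ q * Fintype.card (Fin P.coinLen → Bool)) :
    1 - q ≤ P.prob event := by
  have hpos : (0 : ℝ) < Fintype.card P.Coins := by exact_mod_cast Fintype.card_pos
  have hcompl : ({ω | event ω}ᶜ.ncard : ℝ) ≤ q * Fintype.card P.Coins := by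
    have h1 : {ω | event ω}ᶜ ⊆ {r | ¬ good r} ×ˢ Set.univ :=
      fun ω hω => ⟨fun hg => hω (h ω hg), Set.mem_univ _⟩
    have h2 := Set.ncard_le_ncard h1 (Set.toFinite _)
    rw [Set.ncard_prod, Set.ncard_univ, Nat.card_eq_fintype_card] at h2
    rw [Fintype.card_prod, Nat.cast_mul, ← mul_assoc]
    refine le_trans (by exact_mod_cast h2) (mul_le_mul_of_nonneg_right hq (Nat.cast_nonneg _))
  have hadd : ({ω | event ω}.ncard : ℝ) + {ω | event ω}ᶜ.ncard = Fintype.card P.Coins := by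
    rw [← Nat.card_eq_fintype_card]
    exact_mod_cast Set.ncard_add_ncard_compl _
  rw [Protocol.prob, le_div_iff₀ hpos]
  linarith

theorem le_prob_agreement {n ℓ k c : ℕ} {seat : (Fin c → Bool) → Fin k → Fin n}
    {E : Environment n ℓ} (adv : Adversary (committeeProtocol seat) E) {q : ℝ}
    (hq : ({r | ¬ HonestMajority E (seat r)}.ncard : ℝ) ≤ q * Fintype.card (Fin c → Bool)) :
    1 - q ≤ (committeeProtocol seat).prob
      (fun ω => (committeeProtocol seat).Agreement E ω (adv.trace ω)) :=
  le_prob_of_fst (committeeProtocol seat) (good := fun r => HonestMajority E (seat r))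
    (fun ω hω => agreement (adv.isExecution ω) hω) hq

/-! ### Choice of parameters -/

/-- Number of seats that makes the committee fail with probability at most `1 / n ^ γ`. -/
noncomputable def committeeSize (γ δ : ℝ) (n : ℕ) : ℕ := ⌈γ / δ ^ 2 * Real.log n⌉₊

/-- Number of coin tosses that makes the draw of a seat sufficiently close to uniform. -/
noncomputable def tossesPerSeat (δ : ℝ) (n : ℕ) : ℕ := Nat.clog 2 ⌈n / δ⌉₊

/-- Agreement by a random committee of logarithmic size. -/
noncomputable def randomCommitteeProtocol (γ δ : ℝ) (n ℓ : ℕ) : Protocol n ℓ :=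
  if hn : 0 < n then
    committeeProtocol (drawSeats hn (committeeSize γ δ n) (tossesPerSeat δ n))
  else committeeProtocol (k := 0) (c := 0) fun _ a => a.elim0

theorem le_mul_two_pow_tossesPerSeat {δ : ℝ} (hδ : 0 < δ) (n : ℕ) :
    (n : ℝ) ≤ δ * 2 ^ tossesPerSeat δ n := by
  have h1 : (n : ℝ) / δ ≤ ⌈(n : ℝ) / δ⌉₊ := Nat.le_ceil _
  have h2 : (⌈(n : ℝ) / δ⌉₊ : ℝ) ≤ 2 ^ tossesPerSeat δ n := by
    exact_mod_cast Nat.le_pow_clog one_lt_two _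
  rw [mul_comm, ← div_le_iff₀ hδ]
  exact h1.trans h2

/-- By `1 - x ≤ exp (-x)`, the failure bound is at most `exp (-δ ^ 2 * k)`, and `δ ^ 2 * k ≥ γ * log
n`. -/
theorem failure_le {γ δ : ℝ} (hδ : 0 < δ) (hδ1 : δ ≤ 1) {n : ℕ} (hn : 0 < n) :
    (1 - δ ^ 2) ^ committeeSize γ δ n ≤ 1 / (n : ℝ) ^ γ := by
  have hn' : (0 : ℝ) < n := by exact_mod_cast hn
  have h1 : (1 - δ ^ 2) ^ committeeSize γ δ n ≤ Real.exp (-δ ^ 2) ^ committeeSize γ δ n := by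
    refine pow_le_pow_left₀ (by nlinarith) ?_ _
    have := Real.add_one_le_exp (-δ ^ 2)
    linarith
  refine h1.trans ?_
  rw [← Real.exp_nat_mul, one_div, ← Real.rpow_neg hn'.le, Real.rpow_def_of_pos hn',
    Real.exp_le_exp]
  have h2 : γ / δ ^ 2 * Real.log n ≤ committeeSize γ δ n := Nat.le_ceil _
  have h3 : γ / δ ^ 2 * Real.log n * δ ^ 2 = γ * Real.log n := by field_simp
  nlinarith [mul_le_mul_of_nonneg_right h2 (sq_nonneg δ)]

theorem half_le_log {n : ℕ} (hn : 2 ≤ n) : 1 / 2 ≤ Real.log n := by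
  have h1 : Real.log 2 ≤ Real.log n :=
    Real.log_le_log (by norm_num) (by exact_mod_cast hn)
  linarith [Real.log_two_gt_d9]

theorem committeeSize_le {γ δ : ℝ} (hγ : 0 < γ) (hδ : 0 < δ) {n : ℕ} (hn : 2 ≤ n) :
    (committeeSize γ δ n : ℝ) ≤ (γ / δ ^ 2 + 2) * Real.log n := by
  have hL := half_le_log hn
  have h : (committeeSize γ δ n : ℝ) < γ / δ ^ 2 * Real.log n + 1 :=
    Nat.ceil_lt_add_one (by positivity)
  linarith

theorem clog_le {n : ℕ} (hn : 2 ≤ n) : (Nat.clog 2 n : ℝ) ≤ 4 * Real.log n := by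
  have hL := half_le_log hn
  have h1 : 2 ^ (Nat.clog 2 n - 1) < n := Nat.pow_pred_clog_lt_self one_lt_two hn
  have h2 : 0 < Nat.clog 2 n := Nat.clog_pos one_lt_two hn
  have h3 : ((Nat.clog 2 n - 1 : ℕ) : ℝ) * Real.log 2 ≤ Real.log n := by
    rw [← Real.log_pow]
    exact Real.log_le_log (by positivity) (by exact_mod_cast h1.le)
  rw [Nat.cast_sub h2, Nat.cast_one] at h3
  have h4 : (1 : ℝ) ≤ Nat.clog 2 n := by exact_mod_cast h2
  nlinarith [Real.log_two_gt_d9]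

end AuthBA

/-! ### The main theorem -/

theorem theorem2 (ε γ K : ℝ) (hε : 0 < ε) (hγ : 0 < γ) :
    ∃ (A : ∀ (n ℓ : ℕ), AuthBA.PublicSetup n → AuthBA.Protocol n ℓ) (C : ℝ) (d : ℕ),
      ∀ (n ℓ : ℕ) (S : AuthBA.PublicSetup n), 2 ≤ n →
        (ℓ : ℝ) ≤ K * Real.log n → (S.sigLen : ℝ) ≤ K * Real.log n →
        ((A n ℓ S).rounds : ℝ) ≤ C * Real.log n ^ 2 ∧
        ∀ E : AuthBA.Environment n ℓ, (E.byz.card : ℝ) ≤ (1 / 2 - ε) * n →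
          (∀ (ω : (A n ℓ S).Coins) (τ : AuthBA.Trace n), (A n ℓ S).IsExecution E ω τ →
            (A n ℓ S).HonestFeasible E τ ∧
            (A n ℓ S).Bandwidth E S.sigLen τ (C * Real.log n ^ d) ∧
            ((A n ℓ S).messageCount E τ : ℝ) ≤ C * (n * Real.log n)) ∧
          ∀ adv : AuthBA.Adversary (A n ℓ S) E,
            1 - 1 / (n : ℝ) ^ γ ≤
              (A n ℓ S).prob (fun ω => (A n ℓ S).Agreement E ω (adv.trace ω)) := by
  obtain ⟨δ, hδ, hδ1, hδε⟩ : ∃ δ : ℝ, 0 < δ ∧ δ ≤ 1 ∧ 2 * δ ≤ ε :=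
    ⟨min 1 (ε / 2), by positivity, min_le_left _ _, by linarith [min_le_right 1 (ε / 2)]⟩
  set κ : ℝ := γ / δ ^ 2 + 2 with hκ
  have hκ0 : 0 < κ := by positivity
  -- The product term pays for the bandwidth, `4 * κ` for the message count, and `8` for the
  -- additive constants, using `log n ≥ 1 / 2`. The number of rounds is in fact `O(log n)`.
  refine ⟨fun n ℓ _ => AuthBA.randomCommitteeProtocol γ δ n ℓ,
    2 * (2 * κ + 2) * (2 * |K| + 14) + 4 * κ + 8, 2, ?_⟩
  intro n ℓ S hn hℓ hσ
  have hn0 : 0 < n := by omega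
  have hA : AuthBA.randomCommitteeProtocol γ δ n ℓ = AuthBA.committeeProtocol
      (AuthBA.drawSeats hn0 (AuthBA.committeeSize γ δ n) (AuthBA.tossesPerSeat δ n)) :=
    dif_pos hn0
  have hk : (AuthBA.committeeSize γ δ n : ℝ) ≤ κ * Real.log n := AuthBA.committeeSize_le hγ hδ hn
  have hL := AuthBA.half_le_log hn
  have hc := AuthBA.clog_le hn
  beta_reduce
  -- The types of coins and adversaries depend on the protocol, so it is replaced everywhere at once
  -- by substitution.
  generalize AuthBA.randomCommitteeProtocol γ δ n ℓ = P at hA ⊢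
  subst hA
  set k := AuthBA.committeeSize γ δ n
  set L := Real.log n
  have hKL : K * L ≤ |K| * L := mul_le_mul_of_nonneg_right (le_abs_self K) (by linarith)
  have hrest : 0 ≤ 2 * (2 * κ + 2) * (2 * |K| + 14) := by positivity
  have hLL : L ≤ 2 * L ^ 2 := by nlinarith
  refine ⟨?_, fun E hE => ⟨fun ω τ hτ => ⟨AuthBA.honestFeasible hτ, ?_, ?_⟩, fun adv => ?_⟩⟩
  · have e : ((AuthBA.committeeProtocol (ℓ := ℓ)
        (AuthBA.drawSeats hn0 k (AuthBA.tossesPerSeat δ n))).rounds : ℝ) = k + 2 := by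
      simp [AuthBA.committeeProtocol]
    rw [e]
    nlinarith [mul_nonneg hrest (sq_nonneg L), mul_le_mul_of_nonneg_left hLL hκ0.le]
  · intro t ht u hu p m hm
    refine (AuthBA.bandwidth hτ S.sigLen t ht u hu p m hm).trans ?_
    push_cast
    have h1 : 2 * (k : ℝ) + 1 ≤ (2 * κ + 2) * L := by linarith
    -- Here `14 = 10 + 4`: `5 ≤ 10 * L`, and the name of the signer takes at most `4 * L` bits.
    have h2 : (ℓ : ℝ) + 5 + Nat.clog 2 n + S.sigLen ≤ (2 * |K| + 14) * L := by linarith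
    have h3 := mul_le_mul h1 h2 (by positivity) (by positivity)
    nlinarith [mul_nonneg hκ0.le (sq_nonneg L)]
  · have h1 : ((AuthBA.committeeProtocol (ℓ := ℓ) (AuthBA.drawSeats hn0 k
        (AuthBA.tossesPerSeat δ n))).messageCount E τ : ℝ) ≤ 4 * k * n := by
      exact_mod_cast AuthBA.messageCount_le hτ
    refine h1.trans ?_
    have h2 : (4 * k : ℝ) * n ≤ 4 * (κ * L) * n := by gcongr
    have h3 : 0 ≤ (n : ℝ) * L := by positivity
    nlinarith [mul_nonneg hrest h3]
  · refine (sub_le_sub_left (AuthBA.failure_le hδ hδ1 hn0) 1).trans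
      (AuthBA.le_prob_agreement adv ?_)
    refine AuthBA.card_not_honestMajority_le hn0 k _ E hδ
      (AuthBA.le_mul_two_pow_tossesPerSeat hδ n) (hE.trans ?_)
    exact mul_le_mul_of_nonneg_right (by linarith) (Nat.cast_nonneg n)
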